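/- Let $F$ be a field, with algebraic closure $F^{alg}$. A polynomial $Q \in F[x]$ is called hereditarily irreducible over $F$ if $Q(x^n)$ is irreducible in $F[x]$ for every integer $n \ge 1$. A polynomial $P \in F[x]$ has good heredity over $F$ if there is an integer $n \ge 1$ such that $P(x^n)$ is, up to a nonzero constant factor, a finite (possibly empty) product of polynomials that are hereditarily irreducible over $F$. The field $F$ has good heredity if every polynomial $P \in F[x]$ none of whose zeros in $F^{alg}$ is zero or a root of unity has good heredity over $F$. Corollary. Let $F$ be a field that is finitely generated, as a field extension, over $\mathbb{Q}$, or over a subfield of $\mathbb{F}_p^{alg}$ for some prime $p$. Then $F$ has good heredity. -/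

import Mathlib

open Polynomial

/-- `P` is hereditarily irreducible over `F`: for every integer `n ≥ 1`, the polynomial `P(x ^ n)`
is irreducible over `F`. Here `Polynomial.expand F n P` is `P(x ^ n)`. -/
def HereditarilyIrreducible {F : Type*} [Field F] (P : F[X]) : Prop :=
  ∀ n : ℕ, 0 < n → Irreducible (expand F n P)

/-- `P` has good heredity over `F`: for some integer `n ≥ 1`, the polynomial `P(x ^ n)` is, up to a
nonzero constant, a (possibly empty) finite product of hereditarily irreducible polynomials. -/
def PolynomialHasGoodHeredity {F : Type*} [Field F] (P : F[X]) : Prop :=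
  ∃ n : ℕ, 0 < n ∧ ∃ s : Multiset F[X],
    (∀ Q ∈ s, HereditarilyIrreducible Q) ∧ Associated s.prod (expand F n P)

/-- A field `F` has good heredity: every polynomial over `F`, none of whose zeros in the algebraic
closure of `F` is zero or a root of unity, has good heredity over `F`. (The zero polynomial does
not satisfy the hypothesis, as it vanishes at `0`.) -/
def FieldHasGoodHeredity (F : Type*) [Field F] : Prop :=
  ∀ P : F[X],
    (∀ a : AlgebraicClosure F, aeval a P = 0 → a ≠ 0 ∧ ∀ m : ℕ, 0 < m → a ^ m ≠ 1) →
      PolynomialHasGoodHeredity P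

/-! It suffices to bound the number of irreducible factors of `P(x ^ n)` uniformly in `n`: at an `n`
where the count is maximal, no factor can split further. A factor has a root `β` with `α = β ^ n` a
zero of `P`. Taking norms to `F(α)` shows that `β` has degree at least `n / N`, where `N` bounds the
exponents `m` in `α = ζ * δ ^ m` with `ζ` a root of unity (`le_mul_natDegree_minpoly_of_pow_eq`).
Such an `N` exists by a degree comparison if `α` is transcendental over the base field, and by
Northcott finiteness if `α` is algebraic over `ℚ`. Over a subfield of the algebraic closure of
`𝔽_p`, nonzero algebraic elements are roots of unity. -/

open Polynomial IntermediateField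

/-! ### Degrees of `n`-th roots -/

/-- If `α ^ d = γ ^ n`, then up to a root of unity `α` is a power of exponent
`n / gcd d n`. -/
theorem exists_isOfFinOrder_mul_pow {E : Type*} [Field E] {α γ : E} (hα : α ≠ 0) {d n : ℕ}
    (hd : 0 < d) (h : α ^ d = γ ^ n) :
    ∃ ζ δ : E, IsOfFinOrder ζ ∧ α = ζ * δ ^ (n / d.gcd n) := by
  rcases Nat.eq_zero_or_pos n with rfl | hn
  · refine ⟨α, 1, isOfFinOrder_iff_pow_eq_one.2 ⟨d, hd, by simpa using h⟩, by simp⟩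
  have hγ : γ ≠ 0 := by
    rintro rfl
    rw [zero_pow hn.ne'] at h
    exact hα (pow_eq_zero_iff hd.ne' |>.1 h)
  set g := d.gcd n with hg
  have hg0 : 0 < g := Nat.gcd_pos_of_pos_left _ hd
  obtain ⟨d', hd'⟩ : g ∣ d := Nat.gcd_dvd_left _ _
  obtain ⟨n', hn'⟩ : g ∣ n := Nat.gcd_dvd_right _ _
  have hcop : IsCoprime (d' : ℤ) (n' : ℤ) := by
    rw [Nat.isCoprime_iff_coprime]
    have := Nat.coprime_div_gcd_div_gcd (m := d) (n := n) hg0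
    rwa [← hg, Nat.div_eq_of_eq_mul_right hg0 hd', Nat.div_eq_of_eq_mul_right hg0 hn'] at this
  rw [Nat.div_eq_of_eq_mul_right hg0 hn']
  obtain ⟨a, b, hab⟩ := hcop
  have hζ : (α ^ d' / γ ^ n') ^ g = 1 := by
    rw [div_pow, ← pow_mul, ← pow_mul, mul_comm d', mul_comm n', ← hd', ← hn', h,
      div_self (pow_ne_zero _ hγ)]
  -- By `a * d' + b * n' = 1`, all powers of `γ` cancel and `α` has total exponent 1.
  refine ⟨(α ^ d' / γ ^ n') ^ a, γ ^ a * α ^ b, isOfFinOrder_iff_pow_eq_one.2 ⟨g, hg0, ?_⟩, ?_⟩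
  · rw [← zpow_natCast, zpow_comm, zpow_natCast, hζ, one_zpow]
  · have hγa : γ ^ (n' * a : ℤ) ≠ 0 := zpow_ne_zero _ hγ
    rw [div_zpow, mul_pow]
    simp only [← zpow_natCast, ← zpow_mul]
    rw [mul_comm a, div_mul_eq_mul_div, mul_left_comm, mul_div_assoc, mul_comm,
      div_mul_cancel₀ _ hγa, ← zpow_add₀ hα, mul_comm (d' : ℤ), hab, zpow_one]

/-- The degree of an `n`-th root of `α` over `E` is at least `n / N` if every representation of
`α` as a root of unity times an `m`-th power has `m ≤ N`. -/
theorem le_mul_natDegree_minpoly_of_pow_eq {E Ω : Type*} [Field E] [Field Ω] [Algebra E Ω]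
    {α : E} (hα : α ≠ 0) {N : ℕ}
    (hN : ∀ (ζ δ : E) (m : ℕ), IsOfFinOrder ζ → α = ζ * δ ^ m → m ≤ N)
    {n : ℕ} {β : Ω} (hβ : IsIntegral E β) (h : β ^ n = algebraMap E Ω α) :
    n ≤ N * (minpoly E β).natDegree := by
  have hd := minpoly.natDegree_pos hβ
  -- The norm of `β ^ n = α` from `E(β)` is `α` to the power `[E(β) : E]`.
  have hnorm : Algebra.norm E (AdjoinSimple.gen E β) ^ n = α ^ (minpoly E β).natDegree := by
    rw [← map_pow, ← adjoin.finrank hβ, ← Algebra.norm_algebraMap]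
    congr 1
    apply Subtype.ext
    simpa using! h
  obtain ⟨ζ, δ, hζ, hδ⟩ := exists_isOfFinOrder_mul_pow hα hd hnorm.symm
  have := hN ζ δ _ hζ hδ
  have hg := Nat.gcd_dvd_right (minpoly E β).natDegree n
  calc n = n / (minpoly E β).natDegree.gcd n * (minpoly E β).natDegree.gcd n :=
        (Nat.div_mul_cancel hg).symm
    _ ≤ _ := Nat.mul_le_mul this (Nat.gcd_le_left _ hd)

/-! ### Exponents of transcendental elements -/

theorem relfinrank_adjoin_pow {L E : Type*} [Field L] [Field E] [Algebra L E] {x : E}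
    (hx : Transcendental L x) (n : ℕ) : relfinrank L⟮x ^ n⟯ L⟮x⟯ = n := by
  let f : RatFunc L →ₐ[L] E := (IntermediateField.val L⟮x⟯).comp
    (RatFunc.algEquivOfTranscendental x hx).toAlgHom
  have hf : f RatFunc.X = x := by
    rw [← RatFunc.algebraMap_X]
    simp [f]
  have h1 : L⟮x ^ n⟯ = L⟮(RatFunc.X ^ n : RatFunc L)⟯.map f := by
    rw [adjoin_map, Set.image_singleton, map_pow, hf]
  have h2 : L⟮x⟯ = L⟮(RatFunc.X : RatFunc L)⟯.map f := by
    rw [adjoin_map, Set.image_singleton, hf]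
  rw [h1, h2, relfinrank_map_map, RatFunc.adjoin_X, relfinrank_top_right,
    RatFunc.finrank_eq_max_natDegree, ← RatFunc.algebraMap_X, ← map_pow,
    RatFunc.num_algebraMap, RatFunc.denom_algebraMap]
  simp

/-- Extend `α` to a transcendence basis and let `L` be generated by its other members. -/
theorem exists_transcendental_finite {k E : Type*} [Field k] [Field E] [Algebra k E]
    [Algebra.EssFiniteType k E] {α : E} (hα : Transcendental k α) :
    ∃ L : IntermediateField k E, Transcendental L α ∧ FiniteDimensional L⟮α⟯ E := by
  have hind : AlgebraicIndepOn k id {α} :=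
    (algebraicIndependent_singleton_iff (⟨α, rfl⟩ : ({α} : Set E))).2 hα
  obtain ⟨s, hαs, hs⟩ := exists_isTranscendenceBasis_superset hind
  rw [Set.singleton_subset_iff] at hαs
  have hs' : insert α (s \ {α}) = s := by simp [hαs]
  have hsind : AlgebraicIndepOn k id (insert α (s \ {α})) := by
    rw [hs']
    exact hs.1
  have htr := ((AlgebraicIndepOn.insert_iff (by simp)).1 hsind).2
  rw [Set.image_id, id] at htr
  refine ⟨adjoin k (s \ {α}), transcendental_adjoin_iff.2 htr, ?_⟩
  have halg := hs.isAlgebraic_field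
  have : Algebra.EssFiniteType (adjoin k (s \ {α})) E := .of_comp k _ _
  have : Algebra.EssFiniteType (adjoin k (s \ {α}))⟮α⟯ E := .of_comp (adjoin k (s \ {α})) _ _
  have : Algebra.IsAlgebraic (adjoin k (s \ {α}))⟮α⟯ E := by
    refine ⟨fun x ↦ ?_⟩
    have hle : adjoin k (Set.range ((↑) : s → E)) ≤
        ((adjoin k (s \ {α}))⟮α⟯).restrictScalars k := by
      rw [adjoin_adjoin_left, Subtype.range_coe, Set.union_singleton, hs']
    exact IsAlgebraic.tower_top_of_subalgebra_le (A := (adjoin k (Set.range ((↑) : s → E))).toSubalgebra)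
      (B := (((adjoin k (s \ {α}))⟮α⟯).restrictScalars k).toSubalgebra) hle
      (halg.isAlgebraic x)
  exact Algebra.finite_of_essFiniteType_of_isAlgebraic

/-- If `α ^ r = δ ^ (m * r)`, computing `[E : L(α ^ r)]` through `L(α)` and through `L(δ)` shows
that `m` divides `[E : L(α)]`. -/
theorem exists_forall_exponent_le_of_transcendental {k E : Type*} [Field k] [Field E] [Algebra k E]
    [Algebra.EssFiniteType k E] {α : E} (hα : Transcendental k α) :
    ∃ N : ℕ, ∀ (ζ δ : E) (m : ℕ), IsOfFinOrder ζ → α = ζ * δ ^ m → m ≤ N := by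
  obtain ⟨L, hL, hfin⟩ := exists_transcendental_finite hα
  refine ⟨relfinrank L⟮α⟯ ⊤, fun ζ δ m hζ h ↦ ?_⟩
  have hD : 0 < relfinrank L⟮α⟯ ⊤ := by
    rw [relfinrank_top_right]
    exact Module.finrank_pos
  obtain ⟨r, hr, hζr⟩ := isOfFinOrder_iff_pow_eq_one.1 hζ
  have hpow : α ^ r = δ ^ (m * r) := by rw [h, mul_pow, hζr, one_mul, pow_mul]
  rcases Nat.eq_zero_or_pos m with rfl | hm
  · exact Nat.zero_le _
  have hδ : Transcendental L δ := fun hδ ↦ hL <| by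
    have := hδ.pow (m * r)
    rw [← hpow] at this
    exact this.of_pow hr
  have h1 := relfinrank_mul_relfinrank (A := L⟮α ^ r⟯) (B := L⟮α⟯) (C := ⊤)
    (adjoin_simple_le_iff.2 (pow_mem (mem_adjoin_simple_self L α) r)) le_top
  have h2 := relfinrank_mul_relfinrank (A := L⟮δ ^ (m * r)⟯) (B := L⟮δ⟯) (C := ⊤)
    (adjoin_simple_le_iff.2 (pow_mem (mem_adjoin_simple_self L δ) _)) le_top
  rw [relfinrank_adjoin_pow hL] at h1
  rw [relfinrank_adjoin_pow hδ, ← hpow, ← h1, mul_comm m, mul_assoc] at h2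
  exact Nat.le_of_dvd hD ⟨_, (Nat.eq_of_mul_eq_mul_left hr h2).symm⟩

/-! ### Finiteness of the relative algebraic closure -/

-- After clearing denominators, a relation is a polynomial identity in `s`. Since `s` stays
-- independent over the algebraic closure of `k` in `E`, it can be read off coefficient by
-- coefficient.
open scoped algebraAdjoinAdjoin in
theorem linearIndependent_adjoin_of_isAlgebraic {k E : Type*} [Field k] [Field E] [Algebra k E]
    {s : Set E} (hs : AlgebraicIndependent k ((↑) : s → E)) {ι : Type*}
    {v : ι → algebraicClosure k E} (hv : LinearIndependent k v) :
    LinearIndependent (adjoin k s) (fun i ↦ (v i : E)) := by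
  rw [← LinearIndependent.iff_fractionRing (Algebra.adjoin k s) (adjoin k s),
    linearIndependent_iff']
  intro t g hg
  have hex : ∀ i, ∃ p : MvPolynomial s k, MvPolynomial.aeval ((↑) : s → E) p = (g i : E) := by
    intro i
    obtain ⟨p, hp⟩ := (Algebra.adjoin_eq_range k s).le (g i).2
    exact ⟨p, hp⟩
  choose p hp using hex
  have hA := hs.algebraicClosure
  have hsum : ∑ i ∈ t, MvPolynomial.C (v i) *
      MvPolynomial.map (algebraMap k (algebraicClosure k E)) (p i) = 0 := by
    apply (algebraicIndependent_iff_injective_aeval.1 hA)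
    rw [map_zero, map_sum, ← hg]
    refine Finset.sum_congr rfl fun i _ ↦ ?_
    rw [map_mul, MvPolynomial.aeval_map_algebraMap, hp, MvPolynomial.aeval_C, mul_comm]
    rfl
  intro i hi
  have hpi : p i = 0 := by
    ext c
    refine (linearIndependent_iff'.1 hv) t (fun j ↦ (p j).coeff c) ?_ i hi
    have := congrArg (MvPolynomial.coeff c) hsum
    simpa [MvPolynomial.coeff_sum, MvPolynomial.coeff_C_mul, MvPolynomial.coeff_map,
      Algebra.smul_def, mul_comm] using this
  apply Subtype.ext
  rw [← hp, hpi, map_zero]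
  rfl

/-- A `k`-basis stays independent over `k(s)`, for `s` a transcendence basis, and `E` is finite over
`k(s)`. -/
theorem finiteDimensional_algebraicClosure (k E : Type*) [Field k] [Field E] [Algebra k E]
    [Algebra.EssFiniteType k E] : FiniteDimensional k (algebraicClosure k E) := by
  obtain ⟨s, hs⟩ := exists_isTranscendenceBasis k E
  have halg := hs.isAlgebraic_field
  rw [Subtype.range_coe] at halg
  have : Algebra.EssFiniteType (adjoin k s) E := .of_comp k _ _
  have : FiniteDimensional (adjoin k s) E := Algebra.finite_of_essFiniteType_of_isAlgebraic
  let b := Module.Basis.ofVectorSpace k (algebraicClosure k E)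
  have := (linearIndependent_adjoin_of_isAlgebraic hs.1 b.linearIndependent).finite
  exact Module.Finite.of_basis b

/-! ### Exponents of algebraic numbers -/

theorem NumberField.exists_forall_exponent_le {K : Type*} [Field K] [NumberField K] {α : K}
    (hα : α ≠ 0) (hα' : ¬ IsOfFinOrder α) :
    ∃ N : ℕ, ∀ (ζ δ : K) (m : ℕ), IsOfFinOrder ζ → α = ζ * δ ^ m → m ≤ N := by
  obtain ⟨D, hD, hDα⟩ : ∃ D : ℤ, D ≠ 0 ∧ IsIntegral ℤ (D * α) := by
    have : IsAlgebraic ℤ α := (IsFractionRing.isAlgebraic_iff ℤ ℚ K).2 (Algebra.IsAlgebraic.isAlgebraic α)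
    obtain ⟨D, hD, h⟩ := this.exists_integral_multiple
    exact ⟨D, hD, by simpa using h⟩
  have hDK : (D : K) ≠ 0 := by exact_mod_cast hD
  -- Each `‖φ δ‖` is at most 1 or at most `‖φ δ‖ ^ m = ‖φ α‖`; the sum makes the bound independent
  -- of `φ`.
  let B : ℝ := |(D : ℝ)| * (1 + ∑ φ : K →+* ℂ, ‖φ α‖)
  have hfin := NumberField.Embeddings.finite_of_norm_le K ℂ B
  have hmem : ∀ (ζ δ : K) (m : ℕ), 0 < m → IsOfFinOrder ζ → α = ζ * δ ^ m →
      (D : K) * δ ∈ {x : K | IsIntegral ℤ x ∧ ∀ φ : K →+* ℂ, ‖φ x‖ ≤ B} := by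
    intro ζ δ m hm hζ h
    have hζ0 : ζ ≠ 0 := by rintro rfl; simp [h] at hα
    obtain ⟨r, hr, hζr⟩ := isOfFinOrder_iff_pow_eq_one.1 hζ
    refine ⟨IsIntegral.of_pow hm ?_, fun φ ↦ ?_⟩
    · have hζi : IsIntegral ℤ ζ⁻¹ := by
        refine IsIntegral.of_pow hr ?_
        rw [inv_pow, hζr, inv_one]
        exact isIntegral_one
      have : ((D : K) * δ) ^ m = (D : K) ^ (m - 1) * (ζ⁻¹ * (D * α)) := by
        obtain ⟨m, rfl⟩ := Nat.exists_eq_add_of_lt hm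
        rw [h]
        field_simp
        simp
        ring
      rw [this]
      have hDi : IsIntegral ℤ (D : K) := by
        simpa using (isIntegral_algebraMap (R := ℤ) (A := K) (x := D))
      exact (hDi.pow _).mul (hζi.mul hDα)
    · have hφζ : ‖φ ζ‖ = 1 := by
        refine (pow_eq_one_iff_of_nonneg (norm_nonneg _) hr.ne').1 ?_
        rw [← norm_pow, ← map_pow, hζr, map_one, norm_one]
      have hφδ : ‖φ δ‖ ^ m = ‖φ α‖ := by
        rw [h, map_mul, map_pow, norm_mul, norm_pow, hφζ, one_mul]
      have hle : ‖φ δ‖ ≤ 1 + ‖φ α‖ := by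
        rcases le_total ‖φ δ‖ 1 with h1 | h1
        · linarith [norm_nonneg (φ α)]
        · have := le_self_pow₀ h1 hm.ne'
          linarith
      have hsum : ‖φ α‖ ≤ ∑ φ : K →+* ℂ, ‖φ α‖ :=
        Finset.single_le_sum (f := fun φ : K →+* ℂ ↦ ‖φ α‖) (fun _ _ ↦ norm_nonneg _)
          (Finset.mem_univ φ)
      rw [map_mul, norm_mul, map_intCast, Complex.norm_intCast]
      exact mul_le_mul_of_nonneg_left (by linarith) (abs_nonneg _)
  let M : Set ℕ := {m | 0 < m ∧ ∃ ζ δ : K, IsOfFinOrder ζ ∧ α = ζ * δ ^ m}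
  have hM : M.Finite := by
    by_contra hinf
    have hch : ∀ m, ∃ δ : K, m ∈ M → ∃ ζ, IsOfFinOrder ζ ∧ α = ζ * δ ^ m := by
      intro m
      by_cases hm : m ∈ M
      · obtain ⟨-, ζ, δ, h⟩ := hm
        exact ⟨δ, fun _ ↦ ⟨ζ, h⟩⟩
      · exact ⟨0, fun h ↦ absurd h hm⟩
    choose f hf using hch
    -- Pigeonhole: two exponents share the same `δ`, which is then a root of unity, and so is `α`.
    obtain ⟨m, hm, n, hn, hne, heq⟩ := Set.Infinite.exists_ne_map_eq_of_mapsTo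
      (f := fun m ↦ (D : K) * f m) hinf (fun m hm ↦ by
        obtain ⟨ζ, hζ, h⟩ := hf m hm
        exact hmem ζ _ m hm.1 hζ h) hfin
    replace heq : f m = f n := mul_left_cancel₀ hDK heq
    wlog hlt : m < n generalizing m n
    · exact this n hn m hm hne.symm heq.symm (lt_of_le_of_ne (not_lt.1 hlt) hne.symm)
    obtain ⟨ζ, hζ, h⟩ := hf m hm
    obtain ⟨η, hη, h'⟩ := hf n hn
    rw [← heq] at h'
    set δ := f m
    have hδ0 : δ ≠ 0 := by rintro h0; simp [h, h0, hm.1.ne'] at hα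
    obtain ⟨r, hr, hζr⟩ := isOfFinOrder_iff_pow_eq_one.1 hζ
    obtain ⟨q, hq, hηq⟩ := isOfFinOrder_iff_pow_eq_one.1 hη
    have hδ : IsOfFinOrder δ := by
      refine isOfFinOrder_iff_pow_eq_one.2
        ⟨(n - m) * (r * q), Nat.mul_pos (Nat.sub_pos_of_lt hlt) (Nat.mul_pos hr hq), ?_⟩
      obtain ⟨t, rfl⟩ := Nat.exists_eq_add_of_lt hlt
      have e : ζ = η * δ ^ (m + t + 1 - m) := by
        refine mul_right_cancel₀ (pow_ne_zero m hδ0) ?_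
        rw [← h, h', mul_assoc, ← pow_add]
        congr 2
        omega
      have e2 : ζ ^ (r * q) = (η * δ ^ (m + t + 1 - m)) ^ (r * q) := by rw [← e]
      rw [pow_mul, hζr, one_pow, mul_pow, mul_comm r q, pow_mul η, hηq, one_pow, one_mul,
        ← pow_mul] at e2
      rw [mul_comm r q, ← e2]
    exact hα' (h ▸ hζ.mul (hδ.pow))
  obtain ⟨N, hN⟩ := hM.bddAbove
  refine ⟨N, fun ζ δ m hζ h ↦ ?_⟩
  rcases Nat.eq_zero_or_pos m with rfl | hm
  · exact Nat.zero_le _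
  · exact hN ⟨hm, ζ, δ, hζ, h⟩

theorem exists_forall_exponent_le_of_isAlgebraic_rat {E : Type*} [Field E] [Algebra ℚ E]
    [Algebra.EssFiniteType ℚ E] {α : E} (hα : α ≠ 0) (hα' : ¬ IsOfFinOrder α)
    (halg : IsAlgebraic ℚ α) :
    ∃ N : ℕ, ∀ (ζ δ : E) (m : ℕ), IsOfFinOrder ζ → α = ζ * δ ^ m → m ≤ N := by
  let K := algebraicClosure ℚ E
  have : CharZero K := algebraRat.charZero K
  have hfd := finiteDimensional_algebraicClosure ℚ E
  have : NumberField K := { to_finiteDimensional := by convert! hfd using 1; exact Subsingleton.elim _ _ }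
  have hfo : ∀ x : K, IsOfFinOrder x ↔ IsOfFinOrder (x : E) := fun x ↦
    by simp [isOfFinOrder_iff_pow_eq_one, Subtype.ext_iff]
  obtain ⟨N, hN⟩ := NumberField.exists_forall_exponent_le (K := K) (α := ⟨α, mem_algebraicClosure_iff.2 halg⟩)
    (fun h ↦ hα (congrArg Subtype.val h)) (by rwa [hfo])
  refine ⟨N, fun ζ δ m hζ h ↦ ?_⟩
  rcases Nat.eq_zero_or_pos m with rfl | hm
  · exact Nat.zero_le _
  have hζ0 : ζ ≠ 0 := by rintro rfl; simp [h] at hα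
  obtain ⟨r, hr, hζr⟩ := isOfFinOrder_iff_pow_eq_one.1 hζ
  have hζalg : IsAlgebraic ℚ ζ := by
    refine IsAlgebraic.of_pow hr ?_
    rw [hζr]
    exact isAlgebraic_one
  have hδalg : IsAlgebraic ℚ δ := by
    refine IsAlgebraic.of_pow hm ?_
    have : δ ^ m = ζ⁻¹ * α := by rw [h, inv_mul_cancel_left₀ hζ0]
    rw [this]
    exact hζalg.inv.mul halg
  exact hN ⟨ζ, mem_algebraicClosure_iff.2 hζalg⟩ ⟨δ, mem_algebraicClosure_iff.2 hδalg⟩ m ((hfo _).2 hζ) (Subtype.ext h)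

/-! ### Counting irreducible factors -/

section Counting

variable {F : Type*} [Field F]

open UniqueFactorizationMonoid in
open scoped Classical in
/-- If the number of irreducible factors of `P(x ^ n)` is bounded, then `P` has good heredity. -/
theorem polynomialHasGoodHeredity_of_card_normalizedFactors_le {P : F[X]} (hP : P ≠ 0) {C : ℕ}
    (hC : ∀ n : ℕ, 0 < n → (normalizedFactors (expand F n P)).card ≤ C) :
    PolynomialHasGoodHeredity P := by
  classical
  obtain ⟨c, ⟨n, hn, hnc⟩, hmax⟩ : ∃ c, (∃ n, 0 < n ∧ (normalizedFactors (expand F n P)).card = c) ∧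
      ∀ n, 0 < n → (normalizedFactors (expand F n P)).card ≤ c := by
    let S : Set ℕ := {c | ∃ n, 0 < n ∧ (normalizedFactors (expand F n P)).card = c}
    have hS : S.Nonempty := ⟨_, 1, one_pos, rfl⟩
    have hbdd : BddAbove S := ⟨C, by rintro _ ⟨n, hn, rfl⟩; exact hC n hn⟩
    exact ⟨sSup S, Nat.sSup_mem hS hbdd, fun n hn ↦ le_csSup hbdd ⟨n, hn, rfl⟩⟩
  have hPn : expand F n P ≠ 0 := (expand_ne_zero hn).2 hP
  refine ⟨n, hn, normalizedFactors (expand F n P), fun Q hQ m hm ↦ ?_,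
    prod_normalizedFactors hPn⟩
  by_contra hirr
  obtain ⟨s, hs⟩ := Multiset.exists_cons_of_mem hQ
  have hne : ∀ R ∈ normalizedFactors (expand F n P), expand F m R ≠ 0 := fun R hR ↦
    (expand_ne_zero hm).2 (irreducible_of_normalized_factor R hR).ne_zero
  have hunit : ∀ R ∈ normalizedFactors (expand F n P), ¬ IsUnit (expand F m R) := fun R hR h ↦ by
    have h1 := natDegree_eq_zero_of_isUnit h
    rw [natDegree_expand] at h1
    exact ((irreducible_of_normalized_factor R hR).natDegree_pos.ne')
      ((Nat.mul_eq_zero.1 h1).resolve_right hm.ne')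
  have hone : ∀ R ∈ normalizedFactors (expand F n P),
      1 ≤ (normalizedFactors (expand F m R)).card := fun R hR ↦
    Multiset.card_pos.2 fun h ↦ hunit R hR ((normalizedFactors_eq_zero_iff (hne R hR)).1 h)
  have htwo : 2 ≤ (normalizedFactors (expand F m Q)).card := by
    by_contra hlt
    have h1 : (normalizedFactors (expand F m Q)).card = 1 := by have := hone Q hQ; omega
    obtain ⟨R, hR⟩ := Multiset.card_eq_one.1 h1
    have hass := prod_normalizedFactors (hne Q hQ)
    rw [hR, Multiset.prod_singleton] at hass
    have hRm : R ∈ normalizedFactors (expand F m Q) := by rw [hR]; exact Multiset.mem_singleton_self R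
    exact hirr (hass.irreducible (irreducible_of_normalized_factor R hRm))
  have hcard : ∀ t : Multiset F[X], (∀ R ∈ t, R ∈ normalizedFactors (expand F n P)) →
      expand F m t.prod ≠ 0 ∧ t.card ≤ (normalizedFactors (expand F m t.prod)).card := by
    intro t
    induction t using Multiset.induction with
    | empty => simp
    | cons R t ih =>
      intro h
      obtain ⟨h0, h1⟩ := ih fun R hR ↦ h R (Multiset.mem_cons_of_mem hR)
      have hR := h R (Multiset.mem_cons_self R t)
      rw [Multiset.prod_cons, map_mul]
      refine ⟨mul_ne_zero (hne R hR) h0, ?_⟩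
      rw [normalizedFactors_mul (hne R hR) h0, Multiset.card_add, Multiset.card_cons]
      have := hone R hR
      omega
  -- The factors other than `Q` contribute at least `s.card` and `Q` at least two, so `P(x ^ (m *
  -- n))` exceeds the maximal count.
  obtain ⟨h0, h1⟩ := hcard s fun R hR ↦ hs ▸ Multiset.mem_cons_of_mem hR
  have hass : Associated (expand F m Q * expand F m s.prod) (expand F (m * n) P) := by
    rw [← map_mul, ← Multiset.prod_cons, ← hs, expand_mul]
    exact (prod_normalizedFactors hPn).map (expand F m)
  have := hmax (m * n) (Nat.mul_pos hm hn)
  rw [← (associated_iff_normalizedFactors_eq_normalizedFactors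
    (mul_ne_zero (hne Q hQ) h0) ((expand_ne_zero (Nat.mul_pos hm hn)).2 hP)).1 hass,
    normalizedFactors_mul (hne Q hQ) h0, Multiset.card_add, ← hnc, hs, Multiset.card_cons] at this
  omega

-- The degrees of the factors sum to `n * P.natDegree`, so at most `C * P.natDegree` of them fit.
open UniqueFactorizationMonoid in
theorem polynomialHasGoodHeredity_of_le_mul_natDegree {P : F[X]} (hP : P ≠ 0) {C : ℕ}
    (hC : ∀ (n : ℕ) (R : F[X]), 0 < n → Irreducible R → R ∣ expand F n P → n ≤ C * R.natDegree) :
    PolynomialHasGoodHeredity P := by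
  classical
  refine polynomialHasGoodHeredity_of_card_normalizedFactors_le hP (C := C * P.natDegree)
    fun n hn ↦ ?_
  have hPn : expand F n P ≠ 0 := (expand_ne_zero hn).2 hP
  set s := normalizedFactors (expand F n P) with hs
  have hdeg : (s.map natDegree).sum = P.natDegree * n := by
    rw [← natDegree_expand, ← natDegree_multiset_prod _ (zero_notMem_normalizedFactors _)]
    exact natDegree_eq_of_degree_eq (degree_eq_degree_of_associated (prod_normalizedFactors hPn))
  have hle : s.card * n ≤ (s.map fun R ↦ C * R.natDegree).sum := by
    rw [← smul_eq_mul, ← Multiset.card_map (fun R : F[X] ↦ C * R.natDegree)]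
    refine Multiset.card_nsmul_le_sum fun x hx ↦ ?_
    obtain ⟨R, hR, rfl⟩ := Multiset.mem_map.1 hx
    exact hC n R hn (irreducible_of_normalized_factor R hR) (dvd_of_mem_normalizedFactors hR)
  rw [Multiset.sum_map_mul_left, hdeg, ← mul_assoc] at hle
  exact Nat.le_of_mul_le_mul_right hle hn

theorem fieldHasGoodHeredity_of_forall_exists_exponent_le
    (h : ∀ α : AlgebraicClosure F, α ≠ 0 → ¬ IsOfFinOrder α →
      ∃ N : ℕ, ∀ (ζ δ : F⟮α⟯) (m : ℕ), IsOfFinOrder ζ → AdjoinSimple.gen F α = ζ * δ ^ m → m ≤ N) :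
    FieldHasGoodHeredity F := by
  intro P hP
  have hP0 : P ≠ 0 := by
    rintro rfl
    exact (hP 0 (by simp)).1 rfl
  have hN : ∀ α : AlgebraicClosure F, ∃ N : ℕ, aeval α P = 0 → α ≠ 0 ∧
      ∀ (ζ δ : F⟮α⟯) (m : ℕ), IsOfFinOrder ζ → AdjoinSimple.gen F α = ζ * δ ^ m → m ≤ N := by
    intro α
    by_cases hα : aeval α P = 0
    · obtain ⟨h0, h1⟩ := hP α hα
      obtain ⟨N, hN⟩ := h α h0 fun hfin ↦ by
        obtain ⟨m, hm, hm1⟩ := isOfFinOrder_iff_pow_eq_one.1 hfin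
        exact h1 m hm hm1
      exact ⟨N, fun _ ↦ ⟨h0, hN⟩⟩
    · exact ⟨0, fun h ↦ absurd h hα⟩
  choose N hN using hN
  classical
  refine polynomialHasGoodHeredity_of_le_mul_natDegree hP0
    -- `P` has finitely many zeros, so one constant serves them all.
    (C := (P.aroots (AlgebraicClosure F)).toFinset.sup N) fun n R hn hR hdvd ↦ ?_
  obtain ⟨β, hβ⟩ := IsAlgClosed.exists_aeval_eq_zero (AlgebraicClosure F) R
    (degree_pos_of_irreducible hR).ne'
  have hroot : aeval (β ^ n) P = 0 := by
    rw [← expand_aeval]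
    exact aeval_eq_zero_of_dvd_aeval_eq_zero hdvd hβ
  obtain ⟨h0, h1⟩ := hN _ hroot
  have hint : IsIntegral F β := Algebra.IsIntegral.isIntegral β
  have hle := le_mul_natDegree_minpoly_of_pow_eq (E := F⟮β ^ n⟯) (Ω := AlgebraicClosure F)
    (α := AdjoinSimple.gen F (β ^ n)) (fun h ↦ h0 (congrArg Subtype.val h)) h1
    (n := n) (β := β) hint.tower_top rfl
  refine hle.trans (Nat.mul_le_mul ?_ ?_)
  · exact Finset.le_sup (f := N) (by simp [hP0, hroot])
  · refine (natDegree_le_of_dvd (minpoly.dvd_map_of_isScalarTower F F⟮β ^ n⟯ β)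
      (Polynomial.map_ne_zero (minpoly.ne_zero hint))).trans ?_
    rw [natDegree_map]
    exact natDegree_le_of_dvd (minpoly.dvd F β hβ) hR.ne_zero

end Counting

/-! ### Positive characteristic and conclusion -/

/-- `x` generates a finite field over `ZMod p`, whose unit group is finite. -/
theorem isOfFinOrder_of_isAlgebraic (p : ℕ) [Fact p.Prime] {k K : Type*} [Field k] [Field K]
    [Algebra (ZMod p) k] [Algebra.IsAlgebraic (ZMod p) k] [Algebra k K] {x : K}
    (hxk : IsAlgebraic k x) (hx0 : x ≠ 0) : IsOfFinOrder x := by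
  let : Algebra (ZMod p) K := ((algebraMap k K).comp (algebraMap (ZMod p) k)).toAlgebra
  have : IsScalarTower (ZMod p) k K := .of_algebraMap_eq fun _ ↦ rfl
  have hx : IsAlgebraic (ZMod p) x := hxk.restrictScalars (ZMod p)
  have : FiniteDimensional (ZMod p) (ZMod p)⟮x⟯ := adjoin.finiteDimensional hx.isIntegral
  have : Finite (ZMod p)⟮x⟯ := Module.finite_of_finite (ZMod p)
  have hgen : AdjoinSimple.gen (ZMod p) x ≠ 0 := fun h ↦ hx0 (congrArg Subtype.val h)
  obtain ⟨m, hm, h⟩ := isOfFinOrder_iff_pow_eq_one.1 (isOfFinOrder_of_finite (Units.mk0 _ hgen))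
  refine isOfFinOrder_iff_pow_eq_one.2 ⟨m, hm, ?_⟩
  simpa using congrArg (fun u : (ZMod p)⟮x⟯ˣ ↦ ((u : (ZMod p)⟮x⟯) : K)) h

theorem AdjoinSimple.not_isOfFinOrder_gen {F K : Type*} [Field F] [Field K] [Algebra F K] {α : K}
    (h : ¬ IsOfFinOrder α) : ¬ IsOfFinOrder (AdjoinSimple.gen F α) := fun hg ↦ h <| by
  simpa using (algebraMap F⟮α⟯ K).toMonoidHom.isOfFinOrder hg

theorem corollary33 {F : Type*} [Field F] :
    (∀ [Algebra ℚ F], (⊤ : IntermediateField ℚ F).FG → FieldHasGoodHeredity F) ∧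
    (∀ (p : ℕ) [Fact p.Prime] (k : Subfield (AlgebraicClosure (ZMod p))) [Algebra k F],
      (⊤ : IntermediateField k F).FG → FieldHasGoodHeredity F) := by
  refine ⟨fun hF ↦ ?_, fun p _ k _ hF ↦ ?_⟩
  · rw [fg_top_iff] at hF
    refine fieldHasGoodHeredity_of_forall_exists_exponent_le fun α h0 h1 ↦ ?_
    have : FiniteDimensional F F⟮α⟯ := adjoin.finiteDimensional (Algebra.IsIntegral.isIntegral α)
    have : Algebra.EssFiniteType ℚ F⟮α⟯ := .comp ℚ F F⟮α⟯
    by_cases halg : IsAlgebraic ℚ (AdjoinSimple.gen F α)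
    · exact exists_forall_exponent_le_of_isAlgebraic_rat
        (fun h ↦ h0 (congrArg Subtype.val h)) (AdjoinSimple.not_isOfFinOrder_gen h1) halg
    · exact exists_forall_exponent_le_of_transcendental halg
  · rw [fg_top_iff] at hF
    refine fieldHasGoodHeredity_of_forall_exists_exponent_le fun α h0 h1 ↦ ?_
    have : FiniteDimensional F F⟮α⟯ := adjoin.finiteDimensional (Algebra.IsIntegral.isIntegral α)
    have : Algebra.EssFiniteType k F⟮α⟯ := .comp k F F⟮α⟯
    refine exists_forall_exponent_le_of_transcendental (k := k) fun halg ↦ ?_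
    have : CharP k p := Subfield.charP k p
    let : Algebra (ZMod p) k := ZMod.algebra k p
    let f : k →ₐ[ZMod p] AlgebraicClosure (ZMod p) :=
      { k.subtype with commutes' := fun r ↦ RingHom.congr_fun (Subsingleton.elim
          (k.subtype.comp (algebraMap (ZMod p) k)) (algebraMap (ZMod p) _)) r }
    have : Algebra.IsAlgebraic (ZMod p) k := ⟨fun x ↦
      (isAlgebraic_algHom_iff f f.injective).1 (Algebra.IsAlgebraic.isAlgebraic (f x))⟩
    exact AdjoinSimple.not_isOfFinOrder_gen h1
      (isOfFinOrder_of_isAlgebraic p halg fun h ↦ h0 (congrArg Subtype.val h))
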